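/- All graphs are finite and simple, and $\alpha(G)$ denotes the independence number of $G$ (with $\alpha=0$ for the graph without vertices). For positive integers $s,t$ let $R(s,t)$ be the Ramsey number: the least integer $N$ such that every graph on $n\ge N$ vertices contains an independent set of $s$ vertices or a clique of $t$ vertices. For integers $k>\ell\ge 0$, a graph $G$ is $(k,\ell)$-stable if $\alpha(G-S)\ge \alpha(G)-\ell$ for every $S\subseteq V(G)$ with $|S|=k$; it is tight $(k,\ell)$-stable if, moreover, $\alpha(G)=\left\lfloor\frac{|V(G)|-k+1}{2}\right\rfloor+\ell$. Theorem. Let $k\ge R(2^{74},\,2^{75}-6)$. A graph $G$ with at least $k$ vertices is tight $(k,1)$-stable if and only if, up to isomorphism, $G$ is $K_k$, or $G$ is a spanning subgraph of $K_{k+1}$ or of $K_{k+2}$ with independence number two. In particular, every tight $(k,1)$-stable graph has at most $k+2$ vertices. -/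

import Mathlib

namespace StableGraph

/-- Every graph on `n` vertices contains an independent set of `s` vertices or a clique of
`t` vertices. -/
def RamseyProperty (s t n : ℕ) : Prop :=
  ∀ G : SimpleGraph (Fin n), (∃ I : Finset (Fin n), G.IsNIndepSet s I) ∨
    ∃ K : Finset (Fin n), G.IsNClique t K

/-- The Ramsey number `R(s,t)`: the least `N` such that every graph on `n ≥ N` vertices contains
an independent set of `s` vertices or a clique of `t` vertices. The set is nonempty, see
`ramseyNumber_nonempty`. -/
noncomputable def ramseyNumber (s t : ℕ) : ℕ :=
  sInf {N : ℕ | ∀ n : ℕ, N ≤ n → RamseyProperty s t n}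

theorem exists_ramsey_bound (s : ℕ) : ∀ t : ℕ, ∃ N : ℕ, ∀ (n : ℕ) (G : SimpleGraph (Fin n))
    (A : Finset (Fin n)), N ≤ A.card →
      (∃ I ⊆ A, G.IsNIndepSet s I) ∨ ∃ K ⊆ A, G.IsNClique t K := by
  classical
  induction s with
  | zero => exact fun t => ⟨0, fun n G A _ => Or.inl ⟨∅, by simp, by simp [SimpleGraph.isNIndepSet_iff]⟩⟩
  | succ s ihs =>
    intro t
    induction t with
    | zero => exact ⟨0, fun n G A _ => Or.inr ⟨∅, by simp, by simp [SimpleGraph.isNClique_iff]⟩⟩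
    | succ t iht =>
      obtain ⟨N₁, h₁⟩ := ihs (t + 1)
      obtain ⟨N₂, h₂⟩ := iht
      refine ⟨N₁ + N₂ + 1, fun n G A hA => ?_⟩
      obtain ⟨v, hv⟩ : A.Nonempty := Finset.card_pos.mp (by omega)
      have hsplit := Finset.card_filter_add_card_filter_not (s := A.erase v) (fun w => G.Adj v w)
      rw [Finset.card_erase_of_mem hv] at hsplit
      have hsub : ∀ (p : Fin n → Prop) [DecidablePred p], (A.erase v).filter p ⊆ A := fun p _ =>
        (Finset.filter_subset _ _).trans (Finset.erase_subset _ _)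
      by_cases hC : N₂ ≤ ((A.erase v).filter (fun w => G.Adj v w)).card
      · rcases h₂ n G _ hC with ⟨I, hI, hI'⟩ | ⟨K, hK, hK'⟩
        · exact Or.inl ⟨I, hI.trans (hsub _), hI'⟩
        · refine Or.inr ⟨insert v K, Finset.insert_subset hv (hK.trans (hsub _)), ?_⟩
          exact hK'.insert fun w hw => (Finset.mem_filter.mp (hK hw)).2
      · rcases h₁ n G ((A.erase v).filter (fun w => ¬ G.Adj v w)) (by omega) with
          ⟨I, hI, hI'⟩ | ⟨K, hK, hK'⟩
        · refine Or.inl ⟨insert v I, Finset.insert_subset hv (hI.trans (hsub _)), ?_⟩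
          rw [← SimpleGraph.isNClique_compl] at hI' ⊢
          refine hI'.insert fun w hw => ?_
          have h := Finset.mem_filter.mp (hI hw)
          exact (SimpleGraph.compl_adj _ _ _).mpr ⟨(Finset.ne_of_mem_erase h.1).symm, h.2⟩
        · exact Or.inr ⟨K, hK.trans (hsub _), hK'⟩

theorem ramseyNumber_nonempty (s t : ℕ) :
    {N : ℕ | ∀ n : ℕ, N ≤ n → RamseyProperty s t n}.Nonempty := by
  obtain ⟨N, hN⟩ := exists_ramsey_bound s t
  refine ⟨N, fun n hn G => ?_⟩
  rcases hN n G Finset.univ (by simpa using hn) with ⟨I, _, h⟩ | ⟨K, _, h⟩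
  · exact Or.inl ⟨I, h⟩
  · exact Or.inr ⟨K, h⟩

/-- `G` is `(k,ℓ)`-stable: `α(G - S) ≥ α(G) - ℓ` for every set `S` of exactly `k` vertices.
(For a graph on fewer than `k` vertices this is vacuous.) -/
def IsStable {V : Type*} (G : SimpleGraph V) (k l : ℕ) : Prop :=
  ∀ S : Finset V, S.card = k →
    (G.indepNum : ℤ) - (l : ℤ) ≤ ((G.induce ((S : Set V)ᶜ)).indepNum : ℤ)

/-- `G` is tight `(k,ℓ)`-stable: it is `(k,ℓ)`-stable and
`α(G) = ⌊(|V(G)| - k + 1) / 2⌋ + ℓ`; integer division by `2` is the floor. -/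
def IsTightStable {V : Type*} [Fintype V] (G : SimpleGraph V) (k l : ℕ) : Prop :=
  IsStable G k l ∧
    (G.indepNum : ℤ) = ((Fintype.card V : ℤ) - (k : ℤ) + 1) / 2 + (l : ℤ)

/-- `G` is (isomorphic to) the complete graph `K_m`. -/
def IsComplete {V : Type*} (G : SimpleGraph V) (m : ℕ) : Prop :=
  Nonempty (G ≃g (⊤ : SimpleGraph (Fin m)))

/-- `G` is (isomorphic to) a spanning subgraph of `K_m`, that is, to a graph on all the vertices
of `K_m` each of whose edges is an edge of `K_m`. -/
def IsSpanningSubgraphOfComplete {V : Type*} (G : SimpleGraph V) (m : ℕ) : Prop :=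
  ∃ H : SimpleGraph (Fin m), H ≤ ⊤ ∧ Nonempty (G ≃g H)

end StableGraph

namespace StableGraph

/-! On `k`, `k + 1` or `k + 2` vertices, tightness prescribes `α = 1`, `2`, `2`, and stability is
then immediate. The content is the bound `|V| ≤ k + 2`.

Suppose `|V| ≥ k + 3` and `α = r + 1`. Stability gives `HalfIndependent G r`. If `r` is small,
Ramsey's theorem yields too large an independent set, or a clique violating
`HalfIndependent.card_clique_le`. If `r` is large, `HalfIndependent.exists_larger` gives the
contradiction, as follows.

Subsets of a maximum independent set `A` have neighbourhoods with surplus `k - 3`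
(`card_neighbors_ge`). So Hall's theorem matches `A` minus one vertex out of `A` by some `M`,
avoiding `t` further disjoint edges `w j, w' j`. Any `r` of these `r + t` edges have an independent
transversal, in which choices propagate: if `a` is adjacent to `M b`, choosing `M b` excludes `a`
and so forces `M a`. The surplus makes this propagation expand, so for all but two `u` a few edges
force `M u` (`card_not_forced_le_two`). The forced `M u` are independent, and each `w`-edge has an
end nonadjacent to all of them. These `t` ends have independence number at most 3, hence contain two
disjoint triangles. The triangles and `r - 3` matching edges are `2 * r` vertices without `r`
independent ones. -/

open Classical in
/-- The vertices adjacent to some vertex of `I`. -/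
noncomputable def neighbors {V : Type*} [Fintype V] (G : SimpleGraph V) (I : Finset V) : Finset V :=
  Finset.univ.filter fun v => ∃ a ∈ I, G.Adj a v

theorem mem_neighbors {V : Type*} [Fintype V] {G : SimpleGraph V} {I : Finset V} {v : V} :
    v ∈ neighbors G I ↔ ∃ a ∈ I, G.Adj a v := by
  simp [neighbors]

/-! ### Half-size independent sets and transversals -/

/-- Every set of `2 * r` vertices contains an independent set of `r` vertices. -/
def HalfIndependent {V : Type*} (G : SimpleGraph V) (r : ℕ) : Prop :=
  ∀ X : Finset V, X.card = 2 * r → ∃ I ⊆ X, G.IsIndepSet (I : Set V) ∧ I.card = r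

/-- An independent set contains at most one end of each edge. -/
theorem card_le_of_subset_pairs {V ι : Type*} {G : SimpleGraph V} {f g : ι → V} {J : Finset ι}
    (hadj : ∀ j ∈ J, G.Adj (f j) (g j)) {K : Finset V} (hK : G.IsIndepSet (K : Set V))
    (hsub : ∀ x ∈ K, ∃ j ∈ J, x = f j ∨ x = g j) : K.card ≤ J.card := by
  classical
  have h1 : K ⊆ J.biUnion fun j => K.filter fun x => x = f j ∨ x = g j := by
    intro x hx
    obtain ⟨j, hj, h⟩ := hsub x hx
    exact Finset.mem_biUnion.mpr ⟨j, hj, Finset.mem_filter.mpr ⟨hx, h⟩⟩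
  have h2 := Finset.card_biUnion_le_card_mul J (fun j => K.filter fun x => x = f j ∨ x = g j) 1 (by
    intro j hj
    rw [Finset.card_le_one]
    intro x hx y hy
    rw [Finset.mem_filter] at hx hy
    by_contra hne
    have hn := hK (Finset.mem_coe.mpr hx.1) (Finset.mem_coe.mpr hy.1) hne
    rcases hx.2 with rfl | rfl <;> rcases hy.2 with rfl | rfl
    · exact hne rfl
    · exact hn (hadj j hj)
    · exact hn (hadj j hj).symm
    · exact hne rfl)
  have := Finset.card_le_card h1
  omega

theorem HalfIndependent.exists_disjoint {V : Type*} [Fintype V] {G : SimpleGraph V} {r k : ℕ}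
    (hP : HalfIndependent G r) (hn : Fintype.card V = 2 * r + k) {S : Finset V}
    (hS : S.card ≤ k) :
    ∃ I : Finset V, Disjoint I S ∧ G.IsIndepSet (I : Set V) ∧ I.card = r := by
  classical
  obtain ⟨T, hST, -, hT⟩ := Finset.exists_subsuperset_card_eq (Finset.subset_univ S) hS
    (by rw [Finset.card_univ]; omega)
  obtain ⟨I, hI, h1, h2⟩ := hP Tᶜ (by rw [Finset.card_compl]; omega)
  refine ⟨I, ?_, h1, h2⟩
  rw [Finset.disjoint_left]
  intro x hx hxS
  exact Finset.mem_compl.mp (hI hx) (hST hxS)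

/-- A family of at most `r` among at least `r` disjoint edges has an independent transversal. -/
theorem HalfIndependent.exists_transversal {V ι : Type*} {G : SimpleGraph V} {r : ℕ}
    (hP : HalfIndependent G r) {P : Finset ι} {f g : ι → V}
    (hadj : ∀ i ∈ P, G.Adj (f i) (g i)) (hf : Set.InjOn f P) (hg : Set.InjOn g P)
    (hfg : ∀ i ∈ P, ∀ j ∈ P, f i ≠ g j) (hr : r ≤ P.card) {J : Finset ι} (hJ : J ⊆ P)
    (hJr : J.card ≤ r) :
    ∃ I : Finset V, G.IsIndepSet (I : Set V) ∧ ∀ j ∈ J, f j ∈ I ∨ g j ∈ I := by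
  classical
  -- Pad `J` to exactly `r` edges: `r` independent vertices among their `2 * r` ends must use every
  -- edge.
  obtain ⟨Q, hJQ, hQP, hQ⟩ := Finset.exists_subsuperset_card_eq hJ hJr hr
  have hX : (Q.image f ∪ Q.image g).card = 2 * r := by
    rw [Finset.card_union_of_disjoint, Finset.card_image_of_injOn (hf.mono hQP),
      Finset.card_image_of_injOn (hg.mono hQP)]
    · omega
    · rw [Finset.disjoint_left]
      intro x hx hy
      obtain ⟨i, hi, rfl⟩ := Finset.mem_image.mp hx
      obtain ⟨j, hj, h⟩ := Finset.mem_image.mp hy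
      exact hfg i (hQP hi) j (hQP hj) h.symm
  obtain ⟨I, hI, hind, hc⟩ := hP _ hX
  refine ⟨I, hind, fun j hj => ?_⟩
  by_contra! hcon
  have := card_le_of_subset_pairs (J := Q.erase j)
    (fun i hi => hadj i (hQP (Finset.mem_of_mem_erase hi))) hind (by
      intro x hx
      rcases Finset.mem_union.mp (hI hx) with h | h <;> obtain ⟨i, hi, rfl⟩ := Finset.mem_image.mp h
      · exact ⟨i, Finset.mem_erase.mpr ⟨by rintro rfl; exact hcon.1 hx, hi⟩, Or.inl rfl⟩
      · exact ⟨i, Finset.mem_erase.mpr ⟨by rintro rfl; exact hcon.2 hx, hi⟩, Or.inr rfl⟩)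
  rw [Finset.card_erase_of_mem (hJQ hj)] at this
  have := Finset.card_pos.mpr ⟨j, hJQ hj⟩
  omega

/-! ### Matchings and the surplus of neighbourhoods -/

/-- Hall's theorem for a graph, relative to a set of vertices to be avoided. -/
theorem exists_matching {V : Type*} [Fintype V] {G : SimpleGraph V} {A W : Finset V}
    (h : ∀ I ⊆ A, ∃ N ⊆ neighbors G I, Disjoint N W ∧ I.card ≤ N.card) :
    ∃ M : V → V, Set.InjOn M A ∧ ∀ a ∈ A, G.Adj a (M a) ∧ M a ∉ W := by
  classical
  have := (Finset.all_card_le_biUnion_card_iff_exists_injective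
    (fun a : A => neighbors G {a.1} \ W)).mp (by
      intro s
      obtain ⟨N, hN, hd, hc⟩ := h (s.map (Function.Embedding.subtype _)) (by
        intro x hx
        obtain ⟨y, -, rfl⟩ := Finset.mem_map.mp hx
        exact y.2)
      rw [Finset.card_map] at hc
      refine hc.trans (Finset.card_le_card fun x hx => ?_)
      obtain ⟨a, ha, hax⟩ := mem_neighbors.mp (hN hx)
      obtain ⟨y, hy, rfl⟩ := Finset.mem_map.mp ha
      exact Finset.mem_biUnion.mpr ⟨y, hy, Finset.mem_sdiff.mpr
        ⟨mem_neighbors.mpr ⟨_, Finset.mem_singleton_self _, hax⟩,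
          Finset.disjoint_left.mp hd hx⟩⟩)
  obtain ⟨F, hF, hF'⟩ := this
  refine ⟨fun v => if hv : v ∈ A then F ⟨v, hv⟩ else v, ?_, ?_⟩
  · intro x hx y hy hxy
    simp only [Finset.mem_coe] at hx hy
    simp only [hx, hy, dif_pos] at hxy
    simpa using hF hxy
  · intro a ha
    have := hF' ⟨a, ha⟩
    simp only [Finset.mem_sdiff, mem_neighbors, Finset.mem_singleton, exists_eq_left] at this
    simpa only [ha, dif_pos] using this

/-- If `I` lies in a maximum independent set, then `I` minus two of its vertices, when matched into
its neighbourhood, forces that neighbourhood to be large. -/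
theorem card_neighbors_ge_of_matching {V : Type*} [Fintype V] {G : SimpleGraph V} {r k : ℕ}
    (hP : HalfIndependent G r) (hn : Fintype.card V = 2 * r + k)
    (hα : ∀ I : Finset V, G.IsIndepSet (I : Set V) → I.card ≤ r + 1)
    {I T : Finset V} (hI : G.IsIndepSet (I : Set V)) (hT : T ⊆ I) (hTI : T.card + 2 = I.card)
    {M : V → V} (hM : Set.InjOn M T) (hadj : ∀ a ∈ T, G.Adj a (M a)) :
    I.card + k ≤ (neighbors G I).card + 3 := by
  classical
  by_contra! hlt
  have hMN : T.image M ⊆ neighbors G I := by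
    intro x hx
    obtain ⟨a, ha, rfl⟩ := Finset.mem_image.mp hx
    exact mem_neighbors.mpr ⟨a, hT ha, hadj a ha⟩
  have hc1 : (T.image M).card = T.card := Finset.card_image_of_injOn hM
  have hc2 := Finset.card_sdiff_add_card_eq_card hMN
  have hc3 := Finset.card_sdiff_add_card_eq_card hT
  have hc4 := Finset.card_union_le (I \ T) (neighbors G I \ T.image M)
  -- The deleted set has at most `2 + (|N(I)| - |I| + 2) ≤ k` vertices. What is left of `I ∪ N(I)`
  -- is covered by `|I| - 2` edges, so replacing that part of `K` by `I` gains at least two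
  -- vertices.
  obtain ⟨K, hKd, hK, hKr⟩ := hP.exists_disjoint hn
    (S := (I \ T) ∪ (neighbors G I \ T.image M)) (by omega)
  have hKS : ∀ x ∈ K, (x ∈ I → x ∈ T) ∧ (x ∈ neighbors G I → x ∈ T.image M) := by
    intro x hx
    have := Finset.disjoint_left.mp hKd hx
    simp only [Finset.mem_union, Finset.mem_sdiff, not_or, not_and, not_not] at this
    exact this
  have hin : (K.filter fun x => x ∈ I ∨ x ∈ neighbors G I).card ≤ T.card := by
    refine card_le_of_subset_pairs (f := id) (g := M) hadj
      (fun x hx y hy => hK (Finset.mem_of_mem_filter x hx) (Finset.mem_of_mem_filter y hy)) ?_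
    intro x hx
    obtain ⟨hx, h | h⟩ := Finset.mem_filter.mp hx
    · exact ⟨x, (hKS x hx).1 h, Or.inl rfl⟩
    · obtain ⟨a, ha, rfl⟩ := Finset.mem_image.mp ((hKS x hx).2 h)
      exact ⟨a, ha, Or.inr rfl⟩
  have hout : ((K.filter fun x => ¬ (x ∈ I ∨ x ∈ neighbors G I)) ∪ I).card ≤ r + 1 := by
    refine hα _ ?_
    intro x hx y hy hxy
    simp only [Finset.coe_union, Finset.coe_filter, Set.mem_union, Set.mem_ofPred_eq,
      Finset.mem_coe, not_or, mem_neighbors] at hx hy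
    rcases hx with ⟨hx, -, hx'⟩ | hx <;> rcases hy with ⟨hy, -, hy'⟩ | hy
    · exact hK hx hy hxy
    · exact fun h => hx' ⟨y, hy, h.symm⟩
    · exact fun h => hy' ⟨x, hx, h⟩
    · exact hI hx hy hxy
  rw [Finset.card_union_of_disjoint (by
    rw [Finset.disjoint_left]
    intro x hx hxI
    exact (Finset.mem_filter.mp hx).2 (Or.inl hxI))] at hout
  have := Finset.card_filter_add_card_filter_not (s := K) (fun x => x ∈ I ∨ x ∈ neighbors G I)
  omega

/-- The surplus bound: subsets of a maximum independent set have large neighbourhoods. -/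
theorem card_neighbors_ge {V : Type*} [Fintype V] {G : SimpleGraph V} {r k : ℕ}
    (hP : HalfIndependent G r) (hn : Fintype.card V = 2 * r + k) (hk : 3 ≤ k)
    (hα : ∀ I : Finset V, G.IsIndepSet (I : Set V) → I.card ≤ r + 1)
    {A : Finset V} (hA : G.IsIndepSet (A : Set V)) (hdeg : ∀ a ∈ A, (neighbors G {a}).Nonempty)
    (I : Finset V) : I ⊆ A → 2 ≤ I.card → I.card + k ≤ (neighbors G I).card + 3 := by
  classical
  induction I using Finset.strongInduction with
  | H I ih =>
  intro hIA h2
  obtain ⟨T, hTI, hT⟩ := Finset.exists_subset_card_eq (s := I) (n := I.card - 2) (by omega)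
  have hss : T ⊂ I := Finset.ssubset_iff_subset_ne.mpr ⟨hTI, by rintro rfl; omega⟩
  -- Hall's condition on `T` is the induction hypothesis, using `3 ≤ k`; singletons need `hdeg`.
  obtain ⟨M, hM, hM'⟩ := exists_matching (G := G) (A := T) (W := ∅) (by
    intro J hJ
    refine ⟨neighbors G J, subset_rfl, Finset.disjoint_empty_right _, ?_⟩
    rcases Nat.lt_or_ge J.card 2 with h | h
    · rcases Nat.eq_zero_or_pos J.card with h0 | h0
      · omega
      · obtain ⟨a, rfl⟩ := Finset.card_eq_one.mp (show J.card = 1 by omega)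
        have := Finset.card_pos.mpr (hdeg a (hIA (hTI (hJ (Finset.mem_singleton_self a)))))
        simpa using this
    · have := ih J (Finset.ssubset_of_subset_of_ssubset hJ hss) ((hJ.trans hTI).trans hIA) h
      omega)
  exact card_neighbors_ge_of_matching hP hn hα (fun x hx y hy => hA (hIA hx) (hIA hy)) hTI
    (by omega) hM fun a ha => (hM' a ha).1

/-! ### Disjoint edges and triangles -/

/-- A large set without large independent sets contains many disjoint edges. -/
theorem exists_disjoint_edges {V : Type*} [Nonempty V] {G : SimpleGraph V} {B : Finset V}
    {a : ℕ} (hB : ∀ U ⊆ B, G.IsIndepSet (U : Set V) → U.card ≤ a) :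
    ∀ t : ℕ, a + 2 * t ≤ B.card + 1 → ∃ w w' : ℕ → V,
      (∀ i ∈ Finset.range t, w i ∈ B ∧ w' i ∈ B ∧ G.Adj (w i) (w' i)) ∧
      Set.InjOn w (Finset.range t) ∧ Set.InjOn w' (Finset.range t) ∧
      ∀ i ∈ Finset.range t, ∀ j ∈ Finset.range t, w i ≠ w' j := by
  classical
  intro t
  induction t with
  | zero => exact fun _ => ⟨fun _ => Classical.arbitrary V, fun _ => Classical.arbitrary V, by simp⟩
  | succ t ih =>
    intro ht
    obtain ⟨w, w', h1, h2, h3, h4⟩ := ih (by omega)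
    set D := (Finset.range t).image w ∪ (Finset.range t).image w' with hD
    have hDc : D.card ≤ 2 * t := by
      have h := Finset.card_union_le ((Finset.range t).image w) ((Finset.range t).image w')
      have h' := Finset.card_image_le (s := Finset.range t) (f := w)
      have h'' := Finset.card_image_le (s := Finset.range t) (f := w')
      rw [Finset.card_range] at h' h''
      rw [hD]
      omega
    have hc := Finset.le_card_sdiff D B
    have hni : ¬ G.IsIndepSet ((B \ D : Finset V) : Set V) := fun h => by
      have := hB _ Finset.sdiff_subset h
      omega
    simp only [SimpleGraph.IsIndepSet, Set.Pairwise, not_forall, not_not] at hni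
    obtain ⟨x, hx, y, hy, hxy, hadj⟩ := hni
    simp only [Finset.mem_coe, Finset.mem_sdiff] at hx hy
    have hwD : ∀ i < t, w i ∈ D := fun i hi => Finset.mem_union_left _
      (Finset.mem_image_of_mem _ (Finset.mem_range.mpr hi))
    have hwD' : ∀ i < t, w' i ∈ D := fun i hi => Finset.mem_union_right _
      (Finset.mem_image_of_mem _ (Finset.mem_range.mpr hi))
    have hxw : ∀ i < t, w i ≠ x ∧ w i ≠ y ∧ w' i ≠ x ∧ w' i ≠ y := fun i hi =>
      ⟨fun h => hx.2 (h ▸ hwD i hi), fun h => hy.2 (h ▸ hwD i hi),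
        fun h => hx.2 (h ▸ hwD' i hi), fun h => hy.2 (h ▸ hwD' i hi)⟩
    have key : ∀ (v : ℕ → V) (z : V), Set.InjOn v (Finset.range t) → (∀ i < t, v i ≠ z) →
        Set.InjOn (fun i => if i < t then v i else z) (Finset.range (t + 1)) := by
      intro v z hv hz i hi j hj hij
      simp only [Finset.coe_range, Set.mem_Iio] at hi hj hv
      by_cases hit : i < t <;> by_cases hjt : j < t <;> simp only [hit, hjt, if_true, if_false] at hij
      · exact hv hit hjt hij
      · exact absurd hij (hz i hit)
      · exact absurd hij.symm (hz j hjt)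
      · omega
    refine ⟨fun i => if i < t then w i else x, fun i => if i < t then w' i else y, ?_,
      key w x h2 fun i hi => (hxw i hi).1, key w' y h3 fun i hi => (hxw i hi).2.2.2, ?_⟩
    · intro i _
      by_cases hit : i < t
      · simpa [hit] using h1 i (Finset.mem_range.mpr hit)
      · simpa [hit] using ⟨hx.1, hy.1, hadj⟩
    · intro i _ j _
      by_cases hit : i < t <;> by_cases hjt : j < t <;> simp only [hit, hjt, if_true, if_false]
      · exact h4 i (Finset.mem_range.mpr hit) j (Finset.mem_range.mpr hjt)
      · exact (hxw i hit).2.1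
      · exact ((hxw j hjt).2.2.1).symm
      · exact hxy

/-- A set of more than `s * s + s` vertices, all of whose independent subsets have at most
`s` elements, contains a triangle. -/
theorem exists_triangle {V : Type*} {G : SimpleGraph V} {Z : Finset V} {s : ℕ}
    (hZ : ∀ U ⊆ Z, G.IsIndepSet (U : Set V) → U.card ≤ s) (hc : s * s + s < Z.card) :
    ∃ K ⊆ Z, G.IsNClique 3 K := by
  classical
  obtain ⟨S, hS⟩ := (Z.powerset.filter fun U : Finset V => G.IsIndepSet (U : Set V)).exists_maximal
    ⟨∅, by simp⟩
  have hSm := hS.prop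
  simp only [Finset.mem_filter, Finset.mem_powerset] at hSm
  have hSc := hZ S hSm.1 hSm.2
  have hcov : ∀ z ∈ Z \ S, ∃ x ∈ S, G.Adj x z := by
    intro z hz
    rw [Finset.mem_sdiff] at hz
    by_contra! hcon
    have h := hS.le_of_ge (y := insert z S) (by
      simp only [Finset.mem_filter, Finset.mem_powerset]
      refine ⟨Finset.insert_subset hz.1 hSm.1, ?_⟩
      rw [Finset.coe_insert]
      refine hSm.2.insert fun x hx _ => ⟨fun h => hcon x hx h.symm, hcon x hx⟩) (Finset.subset_insert _ _)
    exact hz.2 (h (Finset.mem_insert_self _ _))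
  choose! p hp hp' using hcov
  -- The maximal independent set `S` dominates `Z`, so some `x ∈ S` has more than `s` neighbours in
  -- `Z \ S`, and these span an edge.
  obtain ⟨x, hx, hxc⟩ := Finset.exists_lt_card_fiber_of_mul_lt_card_of_maps_to
    (s := Z \ S) (t := S) (f := p) (n := s) hp (by
      have := Finset.le_card_sdiff S Z
      have : S.card * s ≤ s * s := Nat.mul_le_mul_right _ hSc
      omega)
  set F := (Z \ S).filter fun z => p z = x with hF
  have hFZ : F ⊆ Z := (Finset.filter_subset _ _).trans Finset.sdiff_subset
  have hni : ¬ G.IsIndepSet (F : Set V) := fun h => by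
    have := hZ F hFZ h
    omega
  simp only [SimpleGraph.IsIndepSet, Set.Pairwise, not_forall, not_not] at hni
  obtain ⟨y, hy, z, hz, -, hadj⟩ := hni
  have hadjx : ∀ v ∈ F, G.Adj x v := fun v hv => by
    obtain ⟨h1, rfl⟩ := Finset.mem_filter.mp hv
    exact hp' v h1
  refine ⟨{x, y, z}, ?_, SimpleGraph.is3Clique_triple_iff.mpr ⟨hadjx y hy, hadjx z hz, hadj⟩⟩
  intro v hv
  simp only [Finset.mem_insert, Finset.mem_singleton] at hv
  rcases hv with rfl | rfl | rfl
  exacts [hSm.1 hx, hFZ hy, hFZ hz]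

/-! ### Propagation of choices along the matching -/

/-- With respect to a matching `M` of `A`, at most `h` matching edges suffice to propagate the
choice of `M a` to the choice of `M u`. -/
def Reaches {V : Type*} (G : SimpleGraph V) (A : Finset V) (M : V → V) (u : V) (h : ℕ) (a : V) :
    Prop :=
  ∃ J ⊆ A, J.card ≤ h ∧ ∀ I : Finset V, G.IsIndepSet (I : Set V) →
    (∀ x ∈ J, x ∈ I ∨ M x ∈ I) → M a ∈ I → M u ∈ I

/-- At most `c` edges of the matching `M` of `A` and one of the edges `w j, w' j` force every
independent transversal to contain `M u`. -/
def Forced {V : Type*} (G : SimpleGraph V) (A : Finset V) (M : V → V) (w w' : ℕ → V) (t c : ℕ)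
    (u : V) : Prop :=
  ∃ J ⊆ A, J.card ≤ c ∧ ∃ j ∈ Finset.range t, ∀ I : Finset V, G.IsIndepSet (I : Set V) →
    (∀ x ∈ J, x ∈ I ∨ M x ∈ I) → w j ∈ I ∨ w' j ∈ I → M u ∈ I

theorem reaches_self {V : Type*} (G : SimpleGraph V) (A : Finset V) (M : V → V) (u : V) (h : ℕ) :
    Reaches G A M u h u :=
  ⟨∅, Finset.empty_subset _, by simp, fun _ _ _ h => h⟩

theorem Reaches.exists_force {V : Type*} {G : SimpleGraph V} {A : Finset V} {M : V → V} {u : V}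
    {h : ℕ} {a v : V} (hr : Reaches G A M u h a) (ha : a ∈ A) (hav : G.Adj a v) :
    ∃ J ⊆ A, J.card ≤ h + 1 ∧ ∀ I : Finset V, G.IsIndepSet (I : Set V) →
      (∀ x ∈ J, x ∈ I ∨ M x ∈ I) → v ∈ I → M u ∈ I := by
  classical
  obtain ⟨J, hJ, hc, hf⟩ := hr
  refine ⟨insert a J, Finset.insert_subset ha hJ, (Finset.card_insert_le _ _).trans (by omega), ?_⟩
  intro I hI hx hv
  refine hf I hI (fun x hxJ => hx x (Finset.mem_insert_of_mem hxJ)) ?_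
  refine (hx a (Finset.mem_insert_self _ _)).resolve_left fun haI => ?_
  exact hI haI hv hav.ne hav

theorem Reaches.step {V : Type*} {G : SimpleGraph V} {A : Finset V} {M : V → V} {u : V}
    {h : ℕ} {a b : V} (hr : Reaches G A M u h a) (ha : a ∈ A) (hab : G.Adj a (M b)) :
    Reaches G A M u (h + 1) b :=
  hr.exists_force ha hab

/-- Whichever end of edge `j` is chosen, it excludes `a` or `b` and so starts a chain ending in `M
u`. Each chain costs `h + 1` edges. -/
theorem forced_of_reaches {V : Type*} {G : SimpleGraph V} {A : Finset V} {M : V → V}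
    {w w' : ℕ → V} {t c h j : ℕ} {u a b : V} (ha : a ∈ A) (hb : b ∈ A)
    (hra : Reaches G A M u h a) (hrb : Reaches G A M u h b) (hj : j ∈ Finset.range t)
    (haw : G.Adj a (w j)) (hbw : G.Adj b (w' j)) (hc : 2 * h + 2 ≤ c) :
    Forced G A M w w' t c u := by
  classical
  obtain ⟨J, hJ, hJc, hJf⟩ := hra.exists_force ha haw
  obtain ⟨K, hK, hKc, hKf⟩ := hrb.exists_force hb hbw
  refine ⟨J ∪ K, Finset.union_subset hJ hK, (Finset.card_union_le _ _).trans (by omega), j, hj, ?_⟩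
  rintro I hI hx (hw | hw)
  · exact hJf I hI (fun x h => hx x (Finset.mem_union_left _ h)) hw
  · exact hKf I hI (fun x h => hx x (Finset.mem_union_right _ h)) hw

theorem exists_selection {V : Type*} {w w' : ℕ → V} {t : ℕ} {p : V → Prop}
    (hw : Set.InjOn w (Finset.range t)) (hw' : Set.InjOn w' (Finset.range t))
    (hww : ∀ i ∈ Finset.range t, ∀ j ∈ Finset.range t, w i ≠ w' j)
    (hp : ∀ j ∈ Finset.range t, p (w j) ∨ p (w' j)) :
    ∃ Z : Finset V, Z.card = t ∧ ∀ z ∈ Z, p z ∧ ∃ j ∈ Finset.range t, z = w j ∨ z = w' j := by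
  classical
  refine ⟨(Finset.range t).image fun j => if p (w j) then w j else w' j, ?_, ?_⟩
  · rw [Finset.card_image_of_injOn, Finset.card_range]
    intro i hi j hj hij
    dsimp only at hij
    split_ifs at hij
    · exact hw hi hj hij
    · exact absurd hij (hww i hi j hj)
    · exact absurd hij.symm (hww j hj i hi)
    · exact hw' hi hj hij
  · intro z hz
    obtain ⟨j, hj, rfl⟩ := Finset.mem_image.mp hz
    have := hp j hj
    refine ⟨?_, j, hj, ?_⟩
    · split_ifs with h
      · exact h
      · exact this.resolve_left h
    · split_ifs
      · exact Or.inl rfl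
      · exact Or.inr rfl

/-- If `u` is not forced, the set of vertices reaching `u` expands at each step until it outgrows
`A`. The neighbour `M b` makes this set start with two elements, as the surplus bound requires. -/
theorem forced_of_adj_matched {V : Type*} [Fintype V] {G : SimpleGraph V} {A L : Finset V}
    {M : V → V} {w w' : ℕ → V} {t k H : ℕ}
    (hsur : ∀ I ⊆ A, 2 ≤ I.card → I.card + k ≤ (neighbors G I).card + 3)
    (hL : ∀ a ∈ A, ∀ v, G.Adj a v → v ∈ L ∨ ∃ b ∈ A, v = M b) (hLc : L.card + 1 ≤ k)
    (hw : Set.InjOn w (Finset.range t)) (hw' : Set.InjOn w' (Finset.range t))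
    (hww : ∀ i ∈ Finset.range t, ∀ j ∈ Finset.range t, w i ≠ w' j)
    (hwL : ∀ i ∈ Finset.range t, w i ∈ L ∧ w' i ∈ L)
    (ht : 2 ≤ t) (hH : A.card ≤ H * (t - 2)) {u b : V} (hu : u ∈ A) (hb : b ∈ A) (hbu : b ≠ u)
    (hub : G.Adj u (M b)) : Forced G A M w w' t (2 * H + 2) u := by
  classical
  by_contra hnf
  let R : ℕ → Finset V := fun h => A.filter (Reaches G A M u h)
  -- `N(R h)` contains no full edge `w j, w' j`, so it misses `t` of the at most `k - 1` vertices of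
  -- `L`. At least `|R h| + (k - 3) - (k - 1 - t)` neighbours are then matched ones, whose partners
  -- lie in `R (h + 1)`.
  have hgrow : ∀ h ≤ H, 2 ≤ (R h).card → (R h).card + (t - 2) ≤ (R (h + 1)).card := by
    intro h hhH h2
    have hs := hsur (R h) (Finset.filter_subset _ _) h2
    obtain ⟨Z, hZc, hZ⟩ := exists_selection (p := fun v => v ∉ neighbors G (R h)) hw hw' hww (by
      intro j hj
      by_contra! hcon
      obtain ⟨⟨a, ha, haw⟩, a', ha', haw'⟩ := hcon.imp mem_neighbors.mp mem_neighbors.mp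
      obtain ⟨ha, hra⟩ := Finset.mem_filter.mp ha
      obtain ⟨ha', hra'⟩ := Finset.mem_filter.mp ha'
      exact hnf (forced_of_reaches ha ha' hra hra' hj haw haw' (by omega)))
    have hZL : Z ⊆ L \ neighbors G (R h) := by
      intro z hz
      obtain ⟨h1, j, hj, rfl | rfl⟩ := hZ z hz
      · exact Finset.mem_sdiff.mpr ⟨(hwL j hj).1, h1⟩
      · exact Finset.mem_sdiff.mpr ⟨(hwL j hj).2, h1⟩
    have h3 := Finset.card_le_card hZL
    have h4 : neighbors G (R h) ⊆ (R (h + 1)).image M ∪ (L ∩ neighbors G (R h)) := by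
      intro v hv
      obtain ⟨a, ha, hav⟩ := mem_neighbors.mp hv
      obtain ⟨haA, hra⟩ := Finset.mem_filter.mp ha
      rcases hL a haA v hav with hvL | ⟨b, hbA, rfl⟩
      · exact Finset.mem_union_right _ (Finset.mem_inter.mpr ⟨hvL, hv⟩)
      · exact Finset.mem_union_left _ (Finset.mem_image_of_mem _
          (Finset.mem_filter.mpr ⟨hbA, hra.step haA hav⟩))
    have h5 := (Finset.card_le_card h4).trans (Finset.card_union_le _ _)
    have h6 := Finset.card_image_le (s := R (h + 1)) (f := M)
    have h7 := Finset.card_sdiff_add_card_inter L (neighbors G (R h))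
    omega
  have hsize : ∀ h ≤ H, 2 + h * (t - 2) ≤ (R (h + 1)).card := by
    intro h
    induction h with
    | zero =>
      intro _
      have : ({u, b} : Finset V) ⊆ R 1 := by
        intro x hx
        simp only [Finset.mem_insert, Finset.mem_singleton] at hx
        rcases hx with rfl | rfl
        · exact Finset.mem_filter.mpr ⟨hu, reaches_self _ _ _ _ _⟩
        · exact Finset.mem_filter.mpr ⟨hb, (reaches_self _ _ _ _ 0).step hu hub⟩
      have := Finset.card_le_card this
      rw [Finset.card_pair hbu.symm] at this
      simpa using this
    | succ h ih =>
      intro hh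
      have h1 := ih (by omega)
      have h2 := hgrow (h + 1) hh (by omega)
      rw [Nat.succ_mul]
      omega
  have h1 := hsize H le_rfl
  have h2 := Finset.card_filter_le A (Reaches G A M u (H + 1))
  have h3 : (R (H + 1)).card ≤ A.card := h2
  omega

/-- An unforced `u` has no neighbour outside `L` except possibly `M u`, so two such vertices
together see all but two vertices of `L`. With three, some edge `w j, w' j` has both ends seen by at
least two of them, hence one of the three sees both ends and is forced. -/
theorem card_not_forced_le_two {V : Type*} [Fintype V] {G : SimpleGraph V} {A L : Finset V}
    {M : V → V} {w w' : ℕ → V} {t k H : ℕ}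
    (hsur : ∀ I ⊆ A, 2 ≤ I.card → I.card + k ≤ (neighbors G I).card + 3)
    (hL : ∀ a ∈ A, ∀ v, G.Adj a v → v ∈ L ∨ ∃ b ∈ A, v = M b) (hLc : L.card + 1 ≤ k)
    (hw : Set.InjOn w (Finset.range t)) (hw' : Set.InjOn w' (Finset.range t))
    (hww : ∀ i ∈ Finset.range t, ∀ j ∈ Finset.range t, w i ≠ w' j)
    (hwL : ∀ i ∈ Finset.range t, w i ∈ L ∧ w' i ∈ L)
    (ht : 7 ≤ t) (hH : A.card ≤ H * (t - 2)) {S : Finset V} (hSA : S ⊆ A)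
    (hS : ∀ u ∈ S, ¬ Forced G A M w w' t (2 * H + 2) u) : S.card ≤ 2 := by
  classical
  by_contra! hS3
  have hN : ∀ u ∈ S, ∀ v, G.Adj u v → v ∈ L ∨ v = M u := by
    intro u hu v huv
    refine (hL u (hSA hu) v huv).imp_right ?_
    rintro ⟨b, hb, rfl⟩
    by_contra hne
    exact hS u hu (forced_of_adj_matched hsur hL hLc hw hw' hww hwL (by omega) hH (hSA hu) hb
      (fun h => hne (by rw [h])) huv)
  have hpair : ∀ u ∈ S, ∀ v ∈ S, u ≠ v → (L \ neighbors G {u, v}).card ≤ 2 := by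
    intro u hu v hv huv
    have h1 := hsur {u, v} (by
      intro x hx
      simp only [Finset.mem_insert, Finset.mem_singleton] at hx
      rcases hx with rfl | rfl
      exacts [hSA hu, hSA hv]) (Finset.card_pair huv).ge
    rw [Finset.card_pair huv] at h1
    have h2 : neighbors G {u, v} ⊆ {M u, M v} ∪ (L ∩ neighbors G {u, v}) := by
      intro x hx
      rw [Finset.mem_union, Finset.mem_inter]
      obtain ⟨a, ha, hax⟩ := mem_neighbors.mp hx
      simp only [Finset.mem_insert, Finset.mem_singleton] at ha ⊢
      rcases ha with rfl | rfl
      · exact (hN _ hu x hax).elim (fun h => Or.inr ⟨h, hx⟩) fun h => Or.inl (Or.inl h)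
      · exact (hN _ hv x hax).elim (fun h => Or.inr ⟨h, hx⟩) fun h => Or.inl (Or.inr h)
    have h3 := (Finset.card_le_card h2).trans (Finset.card_union_le _ _)
    have h4 := Finset.card_le_two (a := M u) (b := M v)
    have h5 := Finset.card_sdiff_add_card_inter L (neighbors G {u, v})
    omega
  obtain ⟨x, y, z, hx, hy, hz, hxy, hxz, hyz⟩ := Finset.two_lt_card_iff.mp hS3
  set E := (L \ neighbors G {x, y}) ∪ ((L \ neighbors G {x, z}) ∪ (L \ neighbors G {y, z})) with hE
  have hEc : E.card ≤ 6 := by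
    have h1 := Finset.card_union_le (L \ neighbors G {x, z}) (L \ neighbors G {y, z})
    have h2 := Finset.card_union_le (L \ neighbors G {x, y})
      ((L \ neighbors G {x, z}) ∪ (L \ neighbors G {y, z}))
    have h3 := hpair x hx y hy hxy
    have h4 := hpair x hx z hz hxz
    have h5 := hpair y hy z hz hyz
    rw [hE]
    omega
  have hcov : ∀ v ∈ L, v ∉ E → (G.Adj x v ∨ G.Adj y v) ∧ (G.Adj x v ∨ G.Adj z v) ∧
      (G.Adj y v ∨ G.Adj z v) := by
    intro v hv hvE
    simp only [hE, Finset.mem_union, Finset.mem_sdiff, mem_neighbors, Finset.mem_insert,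
      Finset.mem_singleton, exists_eq_or_imp, exists_eq_left, hv, true_and, not_or] at hvE
    simpa only [not_and_or, not_not] using hvE
  -- Seven disjoint edges cannot all meet the at most six exceptional vertices.
  obtain ⟨j, hj, h1, h2⟩ : ∃ j ∈ Finset.range t, w j ∉ E ∧ w' j ∉ E := by
    by_contra! hcon
    obtain ⟨Z, hZc, hZ⟩ := exists_selection (p := fun v => v ∈ E) hw hw' hww (fun j hj => by
      by_cases h : w j ∈ E
      · exact Or.inl h
      · exact Or.inr (hcon j hj h))
    have := Finset.card_le_card (fun v hv => (hZ v hv).1 : Z ⊆ E)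
    omega
  have hf : ∀ u ∈ S, ¬ (G.Adj u (w j) ∧ G.Adj u (w' j)) := fun u hu h => hS u hu
    (forced_of_reaches (h := 0) (hSA hu) (hSA hu) (reaches_self _ _ _ _ _)
      (reaches_self _ _ _ _ _) hj h.1 h.2 (by omega))
  obtain ⟨p₁, p₂, p₃⟩ := hcov _ (hwL j hj).1 h1
  obtain ⟨q₁, q₂, q₃⟩ := hcov _ (hwL j hj).2 h2
  have g₁ := hf x hx
  have g₂ := hf y hy
  have g₃ := hf z hz
  clear * - p₁ p₂ p₃ q₁ q₂ q₃ g₁ g₂ g₃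
  tauto

/-- The two certificates and edge `j` involve at most `2 * c + 3` edges, few enough for a common
independent transversal. -/
theorem exists_isIndepSet_of_forced {V : Type*} [Fintype V] {G : SimpleGraph V}
    {A : Finset V} {M : V → V} {w w' : ℕ → V} {t r c : ℕ}
    (htr : ∀ J ⊆ A, ∀ Q ⊆ Finset.range t, J.card + Q.card ≤ r → ∃ I : Finset V,
      G.IsIndepSet (I : Set V) ∧ (∀ x ∈ J, x ∈ I ∨ M x ∈ I) ∧ ∀ j ∈ Q, w j ∈ I ∨ w' j ∈ I)
    (hc : 2 * c + 3 ≤ r) {u v : V} (hu : Forced G A M w w' t c u) (hv : Forced G A M w w' t c v)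
    {j : ℕ} (hj : j ∈ Finset.range t) :
    ∃ I : Finset V, G.IsIndepSet (I : Set V) ∧ M u ∈ I ∧ M v ∈ I ∧ (w j ∈ I ∨ w' j ∈ I) := by
  classical
  obtain ⟨J, hJ, hJc, i, hi, hJf⟩ := hu
  obtain ⟨K, hK, hKc, l, hl, hKf⟩ := hv
  obtain ⟨I, hI, h1, h2⟩ := htr (J ∪ K) (Finset.union_subset hJ hK) {i, l, j} (by
    intro x hx
    simp only [Finset.mem_insert, Finset.mem_singleton] at hx
    rcases hx with rfl | rfl | rfl <;> assumption) (by
      have := Finset.card_union_le J K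
      have := Finset.card_le_three (a := i) (b := l) (c := j)
      omega)
  exact ⟨I, hI, hJf I hI (fun x hx => h1 x (Finset.mem_union_left _ hx)) (h2 i (by simp)),
    hKf I hI (fun x hx => h1 x (Finset.mem_union_right _ hx)) (h2 l (by simp)), h2 j (by simp)⟩

/-! ### The contradiction for large `r` -/

theorem card_le_of_subset_triangles {V : Type*} {G : SimpleGraph V} {K₁ K₂ J I : Finset V}
    {M : V → V} (h₁ : G.IsNClique 3 K₁) (h₂ : G.IsNClique 3 K₂) (hadj : ∀ a ∈ J, G.Adj a (M a))
    (hI : G.IsIndepSet (I : Set V))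
    (hsub : ∀ x ∈ I, x ∈ K₁ ∨ x ∈ K₂ ∨ ∃ j ∈ J, x = j ∨ x = M j) : I.card ≤ J.card + 2 := by
  classical
  have hcl : ∀ K : Finset V, G.IsNClique 3 K → (I ∩ K).card ≤ 1 := by
    intro K hK
    rw [Finset.card_le_one]
    intro x hx y hy
    rw [Finset.mem_inter] at hx hy
    by_contra hne
    exact hI hx.1 hy.1 hne (hK.1 hx.2 hy.2 hne)
  have h3 : (I.filter fun x => ∃ j ∈ J, x = j ∨ x = M j).card ≤ J.card :=
    card_le_of_subset_pairs (f := id) hadj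
      (fun x hx y hy => hI (Finset.mem_of_mem_filter x hx) (Finset.mem_of_mem_filter y hy))
      fun x hx => (Finset.mem_filter.mp hx).2
  have h4 : I ⊆ (I ∩ K₁ ∪ I ∩ K₂) ∪ I.filter fun x => ∃ j ∈ J, x = j ∨ x = M j := by
    intro x hx
    simp only [Finset.mem_union, Finset.mem_inter, Finset.mem_filter]
    rcases hsub x hx with h | h | h
    exacts [Or.inl (Or.inl ⟨hx, h⟩), Or.inl (Or.inr ⟨hx, h⟩), Or.inr ⟨hx, h⟩]
  have h5 := (Finset.card_le_card h4).trans (Finset.card_union_le _ _)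
  have h6 := Finset.card_union_le (I ∩ K₁) (I ∩ K₂)
  have h7 := hcl K₁ h₁
  have h8 := hcl K₂ h₂
  omega

/-- A large graph in which every `2 * r` vertices span an independent set of size `r` has an
independent set of size `r + 2`, when it has one of size `r + 1`. -/
theorem HalfIndependent.exists_larger {V : Type*} [Fintype V] {G : SimpleGraph V} {r k : ℕ}
    (hP : HalfIndependent G r) (hn : Fintype.card V = 2 * r + k) (hk : 200 ≤ k) (hr : 200 ≤ r)
    {A : Finset V} (hA : G.IsIndepSet (A : Set V)) (hAc : A.card = r + 1) :
    ∃ I : Finset V, G.IsIndepSet (I : Set V) ∧ r + 2 ≤ I.card := by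
  classical
  by_contra! hα
  replace hα : ∀ I : Finset V, G.IsIndepSet (I : Set V) → I.card ≤ r + 1 :=
    fun I hI => Nat.le_of_lt_succ (hα I hI)
  have hne : A.Nonempty := Finset.card_pos.mp (by omega)
  -- Only one vertex of `A` can have small degree: by the surplus bound for pairs, two degrees sum
  -- to at least `k - 1`. Dropping a vertex of least degree leaves degrees at least `(k - 1) / 2`.
  obtain ⟨u₀, hu₀, hmin⟩ := Finset.exists_min_image A (fun a => (neighbors G {a}).card) hne
  have hdeg : ∀ a ∈ A.erase u₀, k ≤ 2 * (neighbors G {a}).card + 1 := by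
    intro a ha
    obtain ⟨hau, ha⟩ := Finset.mem_erase.mp ha
    have h1 := card_neighbors_ge_of_matching hP hn hα (I := {a, u₀}) (T := ∅) (M := id)
      (fun x hx y hy => hA (by simp at hx; rcases hx with rfl | rfl <;> assumption)
        (by simp at hy; rcases hy with rfl | rfl <;> assumption)) (Finset.empty_subset _)
      (by rw [Finset.card_pair hau, Finset.card_empty]) (by simp) (by simp)
    rw [Finset.card_pair hau] at h1
    have h2 : neighbors G {a, u₀} ⊆ neighbors G {a} ∪ neighbors G {u₀} := by
      intro x hx
      simpa [mem_neighbors] using hx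
    have h3 := (Finset.card_le_card h2).trans (Finset.card_union_le _ _)
    have h4 := hmin a ha
    omega
  set A' := A.erase u₀ with hA'
  have hA'c : A'.card = r := by rw [hA', Finset.card_erase_of_mem hu₀]; omega
  have hA'A : A' ⊆ A := Finset.erase_subset _ _
  have hsur := card_neighbors_ge hP hn (by omega) hα
    (fun x hx y hy => hA (hA'A hx) (hA'A hy) : G.IsIndepSet (A' : Set V))
    (fun a ha => Finset.card_pos.mp (by have := hdeg a ha; omega))
  -- Then `2 * t ≤ (k - 3) / 2`, so Hall's condition survives the removal of the ends of `t` edges,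
  -- even for a single vertex.
  obtain ⟨t, ht⟩ : ∃ t, t = (k - 3) / 4 := ⟨_, rfl⟩
  have hBc : (Aᶜ).card = r + k - 1 := by rw [Finset.card_compl]; omega
  have : Nonempty V := ⟨u₀⟩
  obtain ⟨w, w', hwB, hw, hw', hww⟩ := exists_disjoint_edges (G := G) (B := Aᶜ) (a := r + 1)
    (fun U _ hU => hα U hU) t (by omega)
  set W := (Finset.range t).image w ∪ (Finset.range t).image w' with hW
  have hWc : W.card ≤ 2 * t := by
    have h := Finset.card_union_le ((Finset.range t).image w) ((Finset.range t).image w')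
    have h' := Finset.card_image_le (s := Finset.range t) (f := w)
    have h'' := Finset.card_image_le (s := Finset.range t) (f := w')
    rw [Finset.card_range] at h' h''
    rw [hW]
    omega
  have hwW : ∀ j ∈ Finset.range t, w j ∈ W ∧ w' j ∈ W := fun j hj =>
    ⟨Finset.mem_union_left _ (Finset.mem_image_of_mem _ hj),
      Finset.mem_union_right _ (Finset.mem_image_of_mem _ hj)⟩
  obtain ⟨M, hM, hMA⟩ := exists_matching (G := G) (A := A') (W := W) (by
    intro I hI
    refine ⟨neighbors G I \ W, Finset.sdiff_subset, Finset.sdiff_disjoint, ?_⟩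
    have hs := Finset.le_card_sdiff W (neighbors G I)
    rcases Nat.lt_or_ge I.card 2 with h | h
    · rcases Nat.eq_zero_or_pos I.card with h0 | h0
      · omega
      · obtain ⟨a, rfl⟩ := Finset.card_eq_one.mp (show I.card = 1 by omega)
        have := hdeg a (hI (Finset.mem_singleton_self a))
        omega
    · have := hsur I hI h
      omega)
  have hadjB : ∀ a ∈ A, ∀ v, G.Adj a v → v ∉ A := fun a ha v hav hv => hA ha hv hav.ne hav
  have hMB : ∀ a ∈ A', M a ∉ A := fun a ha => hadjB a (hA'A ha) _ (hMA a ha).1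
  set L := Aᶜ \ A'.image M with hLdef
  have hLc : L.card + 1 ≤ k := by
    have h1 : A'.image M ⊆ Aᶜ := by
      intro x hx
      obtain ⟨a, ha, rfl⟩ := Finset.mem_image.mp hx
      exact Finset.mem_compl.mpr (hMB a ha)
    have h2 := Finset.card_sdiff_add_card_eq_card h1
    rw [Finset.card_image_of_injOn hM] at h2
    rw [hLdef]
    omega
  have hL : ∀ a ∈ A', ∀ v, G.Adj a v → v ∈ L ∨ ∃ b ∈ A', v = M b := by
    intro a ha v hav
    by_cases h : ∃ b ∈ A', v = M b
    · exact Or.inr h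
    · refine Or.inl (Finset.mem_sdiff.mpr
        ⟨Finset.mem_compl.mpr (hadjB a (hA'A ha) v hav), fun hv => h ?_⟩)
      obtain ⟨b, hb, hbv⟩ := Finset.mem_image.mp hv
      exact ⟨b, hb, hbv.symm⟩
  have hMW : ∀ a ∈ A', ∀ j ∈ Finset.range t, M a ≠ w j ∧ M a ≠ w' j := fun a ha j hj =>
    ⟨fun h => (hMA a ha).2 (h ▸ (hwW j hj).1), fun h => (hMA a ha).2 (h ▸ (hwW j hj).2)⟩
  have hwL : ∀ j ∈ Finset.range t, w j ∈ L ∧ w' j ∈ L := by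
    intro j hj
    refine ⟨Finset.mem_sdiff.mpr ⟨(hwB j hj).1, fun h => ?_⟩,
      Finset.mem_sdiff.mpr ⟨(hwB j hj).2.1, fun h => ?_⟩⟩ <;>
    obtain ⟨a, ha, h⟩ := Finset.mem_image.mp h
    exacts [(hMW a ha j hj).1 h, (hMW a ha j hj).2 h]
  have hAw : ∀ a ∈ A', ∀ j ∈ Finset.range t, a ≠ w j ∧ a ≠ w' j := fun a ha j hj =>
    ⟨fun h => Finset.mem_compl.mp (hwB j hj).1 (h ▸ hA'A ha),
      fun h => Finset.mem_compl.mp (hwB j hj).2.1 (h ▸ hA'A ha)⟩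
  have hMA' : ∀ a ∈ A', ∀ b ∈ A', a ≠ M b := fun a ha b hb h => hMB b hb (h ▸ hA'A ha)
  have htr : ∀ J ⊆ A', ∀ Q ⊆ Finset.range t, J.card + Q.card ≤ r → ∃ I : Finset V,
      G.IsIndepSet (I : Set V) ∧ (∀ x ∈ J, x ∈ I ∨ M x ∈ I) ∧ ∀ j ∈ Q, w j ∈ I ∨ w' j ∈ I := by
    intro J hJ Q hQ hc
    obtain ⟨I, hI, hI'⟩ := hP.exists_transversal (P := A'.disjSum (Finset.range t))
      (f := Sum.elim id w) (g := Sum.elim M w') (J := J.disjSum Q)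
      (by
        rintro (a | j) h
        · exact (hMA a (Finset.inl_mem_disjSum.mp h)).1
        · exact (hwB j (Finset.inr_mem_disjSum.mp h)).2.2)
      (by
        rintro (a | j) h (b | l) h' he <;>
        simp only [Finset.mem_coe, Finset.inl_mem_disjSum, Finset.inr_mem_disjSum] at h h' <;>
        simp only [Sum.elim_inl, Sum.elim_inr, id] at he
        · rw [he]
        · exact absurd he (hAw a h l h').1
        · exact absurd he.symm (hAw b h' j h).1
        · rw [hw h h' he])
      (by
        rintro (a | j) h (b | l) h' he <;>
        simp only [Finset.mem_coe, Finset.inl_mem_disjSum, Finset.inr_mem_disjSum] at h h' <;>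
        simp only [Sum.elim_inl, Sum.elim_inr] at he
        · rw [hM h h' he]
        · exact absurd he (hMW a h l h').2
        · exact absurd he.symm (hMW b h' j h).2
        · rw [hw' h h' he])
      (by
        rintro (a | j) h (b | l) h' <;>
        simp only [Finset.inl_mem_disjSum, Finset.inr_mem_disjSum] at h h' <;>
        simp only [Sum.elim_inl, Sum.elim_inr, id]
        · exact hMA' a h b h'
        · exact (hAw a h l h').2
        · exact (hMW b h' j h).1.symm
        · exact hww j h l h')
      (by rw [Finset.card_disjSum]; omega) (Finset.disjSum_mono hJ hQ)
      (by rw [Finset.card_disjSum]; exact hc)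
    exact ⟨I, hI, fun x hx => hI' (Sum.inl x) (Finset.inl_mem_disjSum.mpr hx),
      fun j hj => hI' (Sum.inr j) (Finset.inr_mem_disjSum.mpr hj)⟩
  -- Enough rounds for growth by `t - 2` to exhaust `A'`, yet about `r / (t - 2)`, so that two
  -- certificates fit into `r` edges.
  obtain ⟨H, hHdef⟩ : ∃ H, H = r / (t - 2) + 1 := ⟨_, rfl⟩
  have hH : A'.card ≤ H * (t - 2) := by
    rw [hA'c, hHdef, Nat.mul_comm]
    exact (Nat.lt_mul_div_succ r (by omega)).le
  have hHr : 2 * (2 * H + 2) + 3 ≤ r := by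
    have : r / (t - 2) ≤ r / 40 := Nat.div_le_div_left (by omega) (by norm_num)
    omega
  set D := A'.filter (Forced G A' M w w' t (2 * H + 2)) with hD
  have hDc : r ≤ D.card + 2 := by
    have h1 := card_not_forced_le_two hsur hL hLc hw hw' hww hwL (by omega) hH
      (S := A' \ D) Finset.sdiff_subset (by
        intro u hu h
        rw [Finset.mem_sdiff] at hu
        exact hu.2 (Finset.mem_filter.mpr ⟨hu.1, h⟩))
    have h2 := Finset.le_card_sdiff D A'
    omega
  have hDA : D ⊆ A' := Finset.filter_subset _ _
  have hFc : (D.image M).card = D.card := Finset.card_image_of_injOn (hM.mono hDA)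
  have hFind : ∀ u ∈ D, ∀ v ∈ D, ¬ G.Adj (M u) (M v) := by
    intro u hu v hv hadj
    obtain ⟨I, hI, h1, h2, -⟩ := exists_isIndepSet_of_forced htr hHr
      (Finset.mem_filter.mp hu).2 (Finset.mem_filter.mp hv).2
      (Finset.mem_range.mpr (show 0 < t by omega))
    exact hI h1 h2 hadj.ne hadj
  obtain ⟨Z, hZc, hZ⟩ := exists_selection (p := fun z => ∀ u ∈ D, ¬ G.Adj (M u) z) hw hw' hww (by
    intro j hj
    by_contra! hcon
    obtain ⟨⟨u, hu, hadj⟩, v, hv, hadj'⟩ := hcon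
    obtain ⟨I, hI, h1, h2, h3 | h3⟩ := exists_isIndepSet_of_forced htr hHr
      (Finset.mem_filter.mp hu).2 (Finset.mem_filter.mp hv).2 hj
    · exact hI h1 h3 hadj.ne hadj
    · exact hI h2 h3 hadj'.ne hadj')
  -- `U` extends the independent set `D.image M`, which already has at least `r - 2` of the at most
  -- `r + 1` vertices.
  have hZα : ∀ U ⊆ Z, G.IsIndepSet (U : Set V) → U.card ≤ 3 := by
    intro U hUZ hU
    have hdis : Disjoint U (D.image M) := by
      rw [Finset.disjoint_left]
      intro x hx hxD
      obtain ⟨a, ha, rfl⟩ := Finset.mem_image.mp hxD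
      obtain ⟨-, j, hj, h | h⟩ := hZ _ (hUZ hx)
      exacts [(hMW a (hDA ha) j hj).1 h, (hMW a (hDA ha) j hj).2 h]
    have h := hα (U ∪ D.image M) (by
      intro x hx y hy hxy
      simp only [Finset.coe_union, Set.mem_union, Finset.mem_coe, Finset.mem_image] at hx hy
      rcases hx with hx | ⟨a, ha, rfl⟩ <;> rcases hy with hy | ⟨b, hb, rfl⟩
      · exact hU hx hy hxy
      · exact fun h => (hZ x (hUZ hx)).1 b hb h.symm
      · exact fun h => (hZ y (hUZ hy)).1 a ha h
      · exact hFind a ha b hb)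
    rw [Finset.card_union_of_disjoint hdis] at h
    omega
  obtain ⟨K₁, hK₁Z, hK₁⟩ := exists_triangle hZα (by omega)
  obtain ⟨K₂, hK₂Z, hK₂⟩ := exists_triangle (Z := Z \ K₁)
    (fun U hU => hZα U (hU.trans Finset.sdiff_subset)) (by
      have := Finset.le_card_sdiff K₁ Z
      have := hK₁.card_eq
      omega)
  obtain ⟨J, hJA, hJc⟩ := Finset.exists_subset_card_eq (s := A') (n := r - 3) (by omega)
  have hKd : Disjoint K₁ K₂ := Finset.disjoint_of_subset_right hK₂Z Finset.disjoint_sdiff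
  have hKZ : K₁ ∪ K₂ ⊆ Z := Finset.union_subset hK₁Z (hK₂Z.trans Finset.sdiff_subset)
  have hJd : Disjoint J (J.image M) := by
    rw [Finset.disjoint_left]
    intro x hx hx'
    obtain ⟨b, hb, h⟩ := Finset.mem_image.mp hx'
    exact hMA' x (hJA hx) b (hJA hb) h.symm
  have hd : Disjoint (K₁ ∪ K₂) (J ∪ J.image M) := by
    rw [Finset.disjoint_left]
    intro x hx hx'
    obtain ⟨-, j, hj, h⟩ := hZ x (hKZ hx)
    rcases Finset.mem_union.mp hx' with hx' | hx'
    · exact h.elim (hAw x (hJA hx') j hj).1 (hAw x (hJA hx') j hj).2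
    · obtain ⟨a, ha, rfl⟩ := Finset.mem_image.mp hx'
      exact h.elim (hMW a (hJA ha) j hj).1 (hMW a (hJA ha) j hj).2
  obtain ⟨I, hIX, hI, hIc⟩ := hP ((K₁ ∪ K₂) ∪ (J ∪ J.image M)) (by
    rw [Finset.card_union_of_disjoint hd, Finset.card_union_of_disjoint hKd,
      Finset.card_union_of_disjoint hJd, Finset.card_image_of_injOn (hM.mono hJA), hK₁.card_eq,
      hK₂.card_eq]
    omega)
  have := card_le_of_subset_triangles hK₁ hK₂ (fun a ha => (hMA a (hJA ha)).1) hI (by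
    intro x hx
    have := hIX hx
    simp only [Finset.mem_union, Finset.mem_image] at this
    rcases this with (h | h) | h | ⟨a, ha, rfl⟩
    exacts [Or.inl h, Or.inr (Or.inl h), Or.inr (Or.inr ⟨x, h, Or.inl rfl⟩),
      Or.inr (Or.inr ⟨a, ha, Or.inr rfl⟩)])
  omega

/-! ### From stability to the bound on the order -/

theorem IsStable.exists_disjoint {V : Type*} [Fintype V] {G : SimpleGraph V} {k l : ℕ}
    (h : IsStable G k l) {S : Finset V} (hS : S.card = k) :
    ∃ I : Finset V, Disjoint I S ∧ G.IsIndepSet (I : Set V) ∧ G.indepNum ≤ I.card + l := by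
  obtain ⟨s, hs⟩ := (G.induce ((S : Set V)ᶜ)).exists_isNIndepSet_indepNum
  refine ⟨s.map (Function.Embedding.subtype _), ?_, ?_, ?_⟩
  · rw [Finset.disjoint_left]
    intro x hx
    obtain ⟨y, -, rfl⟩ := Finset.mem_map.mp hx
    exact y.2
  · intro x hx y hy hxy
    obtain ⟨x, hx', rfl⟩ := Finset.mem_map.mp (Finset.mem_coe.mp hx)
    obtain ⟨y, hy', rfl⟩ := Finset.mem_map.mp (Finset.mem_coe.mp hy)
    exact hs.1 hx' hy' fun h => hxy (h ▸ rfl)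
  · rw [Finset.card_map, hs.2]
    have := h S hS
    omega

theorem RamseyProperty.exists_of_card {s t n : ℕ} (h : RamseyProperty s t n) {V : Type*} [Fintype V]
    (hn : Fintype.card V = n) (G : SimpleGraph V) :
    (∃ I : Finset V, G.IsNIndepSet s I) ∨ ∃ K : Finset V, G.IsNClique t K := by
  let e : Fin n ≃ V := (Fintype.equivFinOfCardEq hn).symm
  have hmem : ∀ (I : Finset (Fin n)) (x : V), x ∈ I.map e.toEmbedding → ∃ i ∈ I, e i = x :=
    fun I x hx => Finset.mem_map.mp hx
  rcases h (G.comap e) with ⟨I, hI⟩ | ⟨K, hK⟩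
  · refine Or.inl ⟨I.map e.toEmbedding, fun x hx y hy hxy => ?_, by rw [Finset.card_map, hI.2]⟩
    obtain ⟨i, hi, rfl⟩ := hmem I x hx
    obtain ⟨j, hj, rfl⟩ := hmem I y hy
    exact hI.1 hi hj fun h => hxy (h ▸ rfl)
  · refine Or.inr ⟨K.map e.toEmbedding, fun x hx y hy hxy => ?_, by rw [Finset.card_map, hK.2]⟩
    obtain ⟨i, hi, rfl⟩ := hmem K x hx
    obtain ⟨j, hj, rfl⟩ := hmem K y hy
    exact hK.1 hi hj fun h => hxy (h ▸ rfl)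

theorem ramseyProperty_of_le {s t n : ℕ} (h : ramseyNumber s t ≤ n) : RamseyProperty s t n :=
  Nat.sInf_mem (ramseyNumber_nonempty s t) n h

theorem le_ramseyNumber {s t : ℕ} (ht : 2 ≤ t) : s ≤ ramseyNumber s t := by
  rcases ramseyProperty_of_le (le_refl (ramseyNumber s t)) ⊥ with ⟨I, hI⟩ | ⟨K, hK⟩
  · have := Finset.card_le_univ I
    rw [hI.2, Fintype.card_fin] at this
    exact this
  · obtain ⟨x, hx, y, hy, hxy⟩ := Finset.one_lt_card.mp (show 1 < K.card by rw [hK.2]; omega)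
    exact absurd (hK.1 hx hy hxy) (by simp)

/-- A clique in a graph in which every `2 * r` vertices span an independent set of size `r` has
at most `r + 1` vertices. -/
theorem HalfIndependent.card_clique_le {V : Type*} [Fintype V] {G : SimpleGraph V} {r : ℕ}
    (hP : HalfIndependent G r) (hr : 2 ≤ r) (hn : 2 * r ≤ Fintype.card V) {K : Finset V}
    (hK : G.IsClique (K : Set V)) : K.card ≤ r + 1 := by
  classical
  by_contra! hc
  obtain ⟨T, hTK, hT⟩ := Finset.exists_subset_card_eq (s := K) (n := r + 2) (by omega)
  obtain ⟨X, hTX, -, hX⟩ := Finset.exists_subsuperset_card_eq (Finset.subset_univ T)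
    (show T.card ≤ 2 * r by omega) (by rw [Finset.card_univ]; exact hn)
  obtain ⟨I, hIX, hI, hIc⟩ := hP X hX
  -- So `I` has at most one vertex in the clique and `r - 2` outside it, fewer than `r`.
  have h1 : (I ∩ T).card ≤ 1 := by
    rw [Finset.card_le_one]
    intro x hx y hy
    rw [Finset.mem_inter] at hx hy
    by_contra hne
    exact hI hx.1 hy.1 hne (hK (hTK hx.2) (hTK hy.2) hne)
  have h2 := Finset.card_le_card (Finset.sdiff_subset_sdiff hIX (subset_refl T))
  have h3 := Finset.card_sdiff_add_card_eq_card hTX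
  have h4 := Finset.card_sdiff_add_card_inter I T
  omega

/-- The Ramsey bound only has to settle `r + 1 < s`; for larger `r` the structural argument applies,
and `300 ≤ s` leaves room for its thresholds of 200. -/
theorem IsTightStable.card_le {k s t : ℕ} (hk : ramseyNumber s t ≤ k) (hs : 300 ≤ s) (hst : s ≤ t)
    {V : Type*} [Fintype V] {G : SimpleGraph V} (h : IsTightStable G k 1) :
    Fintype.card V ≤ k + 2 := by
  classical
  by_contra! hn
  obtain ⟨m, hm⟩ : ∃ m, Fintype.card V = k + m := ⟨Fintype.card V - k, by omega⟩
  obtain ⟨r, hr⟩ : ∃ r, r = (m + 1) / 2 := ⟨_, rfl⟩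
  have hα : G.indepNum = r + 1 := by
    have := h.2
    rw [hm] at this
    push_cast at this
    omega
  have hk' : s ≤ k := (le_ramseyNumber (by omega)).trans hk
  have hP : HalfIndependent G r := by
    intro X hX
    obtain ⟨S, hXS, -, hS⟩ := Finset.exists_subsuperset_card_eq
      (s := Xᶜ) (t := Finset.univ) (n := k) (Finset.subset_univ _)
      (by rw [Finset.card_compl]; omega) (by rw [Finset.card_univ]; omega)
    obtain ⟨I, hIS, hI, hIc⟩ := h.1.exists_disjoint hS
    obtain ⟨J, hJI, hJ⟩ := Finset.exists_subset_card_eq (s := I) (n := r) (by omega)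
    refine ⟨J, fun x hx => ?_, fun x hx y hy => hI (hJI hx) (hJI hy), hJ⟩
    by_contra hxX
    exact Finset.disjoint_left.mp hIS (hJI hx) (hXS (Finset.mem_compl.mpr hxX))
  rcases le_or_gt s (r + 1) with hrs | hrs
  -- By the parity of `m`, the parameter `|V| - 2 * r` is `k` or `k - 1`.
  · obtain ⟨A, hA⟩ := G.exists_isNIndepSet_indepNum
    obtain ⟨I, hI, hIc⟩ := hP.exists_larger (k := Fintype.card V - 2 * r) (by omega) (by omega)
      (by omega) hA.1 (by rw [hA.2, hα])
    have := hI.card_le_indepNum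
    omega
  · rcases (ramseyProperty_of_le (hk.trans (show k ≤ k + m by omega))).exists_of_card hm G with
      ⟨I, hI⟩ | ⟨K, hK⟩
    · have := hI.1.card_le_indepNum
      rw [hI.2] at this
      omega
    · have := hP.card_clique_le (by omega) (by omega) hK.1
      rw [hK.2] at this
      omega

/-! ### Graphs on at most `k + 2` vertices -/

theorem isStable_of_indepNum_le {V : Type*} [Fintype V] {G : SimpleGraph V} {k l : ℕ}
    (h : G.indepNum ≤ l) : IsStable G k l := by
  intro S _
  omega

theorem isStable_one_of_indepNum_eq_two {V : Type*} [Fintype V] {G : SimpleGraph V} {k : ℕ}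
    (h : G.indepNum = 2) (hk : k < Fintype.card V) : IsStable G k 1 := by
  classical
  intro S hS
  obtain ⟨v, hv⟩ : (Sᶜ).Nonempty := Finset.card_pos.mp (by rw [Finset.card_compl]; omega)
  have := SimpleGraph.IsIndepSet.card_le_indepNum (G := G.induce ((S : Set V)ᶜ))
    (t := {⟨v, by simpa using hv⟩}) (by simp [SimpleGraph.IsIndepSet])
  rw [Finset.card_singleton] at this
  omega

theorem isSpanningSubgraphOfComplete_iff {V : Type*} [Fintype V] {G : SimpleGraph V} {m : ℕ} :
    IsSpanningSubgraphOfComplete G m ↔ Fintype.card V = m := by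
  constructor
  · rintro ⟨H, -, ⟨e⟩⟩
    simpa using Fintype.card_congr e.toEquiv
  · intro h
    exact ⟨_, le_top, ⟨SimpleGraph.overFinIso G h⟩⟩

theorem isComplete_iff {V : Type*} [Fintype V] {G : SimpleGraph V} {m : ℕ} :
    IsComplete G m ↔ Fintype.card V = m ∧ G = ⊤ := by
  constructor
  · rintro ⟨e⟩
    refine ⟨by simpa using Fintype.card_congr e.toEquiv, ?_⟩
    ext x y
    rw [← e.map_rel_iff]
    simp
  · rintro ⟨h, rfl⟩
    exact ⟨SimpleGraph.Iso.completeGraph (Fintype.equivFinOfCardEq h)⟩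

theorem eq_top_iff_indepNum_eq_one {V : Type*} [Fintype V] [Nonempty V] {G : SimpleGraph V} :
    G = ⊤ ↔ G.indepNum = 1 := by
  classical
  constructor
  · rintro rfl
    obtain ⟨A, hA⟩ := (⊤ : SimpleGraph V).exists_isNIndepSet_indepNum
    have h1 : A.card ≤ 1 := by
      rw [Finset.card_le_one]
      intro x hx y hy
      by_contra hne
      exact hA.1 hx hy hne hne
    have h2 := SimpleGraph.IsIndepSet.card_le_indepNum (G := (⊤ : SimpleGraph V))
      (t := {Classical.arbitrary V}) (by simp [SimpleGraph.IsIndepSet])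
    rw [Finset.card_singleton] at h2
    rw [hA.2] at h1
    omega
  · intro h
    rw [eq_top_iff]
    intro x y hxy
    by_contra hadj
    have := SimpleGraph.IsIndepSet.card_le_indepNum (G := G) (t := {x, y}) (by
      intro a ha b hb hab
      simp only [Finset.coe_insert, Finset.coe_singleton, Set.mem_insert_iff,
        Set.mem_singleton_iff] at ha hb
      rcases ha with rfl | rfl <;> rcases hb with rfl | rfl
      · exact absurd rfl hab
      · exact hadj
      · exact fun h => hadj h.symm
      · exact absurd rfl hab)
    rw [Finset.card_pair hxy.ne] at this
    omega

end StableGraph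

theorem theorem1p9 (k : ℕ)
    (hk : StableGraph.ramseyNumber (2 ^ 74) (2 ^ 75 - 6) ≤ k)
    {V : Type*} [Fintype V] (G : SimpleGraph V) :
    (k ≤ Fintype.card V →
      (StableGraph.IsTightStable G k 1 ↔
        StableGraph.IsComplete G k ∨
          ((StableGraph.IsSpanningSubgraphOfComplete G (k + 1) ∨
              StableGraph.IsSpanningSubgraphOfComplete G (k + 2)) ∧
            G.indepNum = 2))) ∧
    (StableGraph.IsTightStable G k 1 → Fintype.card V ≤ k + 2) := by
  have hcard : StableGraph.IsTightStable G k 1 → Fintype.card V ≤ k + 2 := fun h =>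
    h.card_le hk (by norm_num) (by norm_num)
  have hk0 : 0 < k := lt_of_lt_of_le (by norm_num)
    ((StableGraph.le_ramseyNumber (s := 2 ^ 74) (t := 2 ^ 75 - 6) (by norm_num)).trans hk)
  refine ⟨fun hn => ?_, hcard⟩
  have hne : Nonempty V := Fintype.card_pos_iff.mp (by omega)
  rw [StableGraph.isComplete_iff, StableGraph.isSpanningSubgraphOfComplete_iff,
    StableGraph.isSpanningSubgraphOfComplete_iff, StableGraph.eq_top_iff_indepNum_eq_one]
  constructor
  -- With `k ≤ |V| ≤ k + 2`, the tightness formula leaves only the listed pairs of order and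
  -- independence number.
  · intro h
    have h1 := hcard h
    have h2 := h.2
    push_cast at h2
    omega
  · rintro (⟨h1, h2⟩ | ⟨h1, h2⟩)
    · exact ⟨StableGraph.isStable_of_indepNum_le h2.le, by rw [h1, h2]; push_cast; omega⟩
    · refine ⟨StableGraph.isStable_one_of_indepNum_eq_two h2 (by omega), ?_⟩
      rw [h2]
      rcases h1 with h1 | h1 <;> rw [h1] <;> push_cast <;> omega
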